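/- Let $n\ge 1$ and let $\Phi:\mathbb R^n\to\mathbb R$ be a smooth ($C^\infty$) convex function satisfying the Kähler–Einstein equation $e^{-\Phi}=\det D^2\Phi$ on $\mathbb R^n$ (for instance, the solution with $\nabla\Phi(\mathbb R^n)=\operatorname{int}K$ associated with a convex body $K\subset\mathbb R^n$ whose barycenter is at the origin). Equip $\mathbb R^n$ with the Riemannian metric $h=\sum_{i,j}\Phi_{ij}\,dx^i dx^j$, where $\Phi_{ij}=\partial^2_{x_ix_j}\Phi$, and for a $C^2$ function $u$ put $$Lu=\sum_{i,j=1}^n\Phi^{ij}\,\partial^2_{x_ix_j}u,\qquad (\Phi^{ij})=(\Phi_{ij})^{-1}.$$ For $e\in\mathbb R^n$ write $\Phi_{ee}(x)=D^2\Phi(x)[e,e]$ and $\Phi_{eee}(x)=D^3\Phi(x)[e,e,e]$. Then for every $x\in\mathbb R^n$ the maximum $$f(x)=\max\{\Phi_{eee}(x)\,:\,e\in\mathbb R^n,\ \Phi_{ee}(x)=1\}$$ of $\Phi_{eee}(x)$ over the Riemannian unit vectors at $x$ is attained, and $f$ satisfies $$Lf\ \ge\ \tfrac12 f+\tfrac14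 f^3\quad\text{on }\mathbb R^n$$ in the barrier sense, that is: $f$ is continuous, and for every $x_0\in\mathbb R^n$ there are an open neighbourhood $U$ of $x_0$ and a $C^\infty$ function $\varphi$ on $U$ with $\varphi\le f$ on $U$, $\varphi(x_0)=f(x_0)$ and $$(L\varphi)(x_0)\ \ge\ \tfrac12 f(x_0)+\tfrac14 f(x_0)^3 .$$ -/

import Mathlib

open scoped ContDiff

noncomputable section

namespace KahlerEinstein

/-- The Euclidean Hessian matrix `(∂²u/∂xᵢ∂xⱼ)(x)`. -/
def hessianMatrix {n : ℕ} (u : EuclideanSpace ℝ (Fin n) → ℝ)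
    (x : EuclideanSpace ℝ (Fin n)) : Matrix (Fin n) (Fin n) ℝ :=
  Matrix.of fun i j =>
    iteratedFDeriv ℝ 2 u x ![EuclideanSpace.single i 1, EuclideanSpace.single j 1]

/-- `Φ` is a smooth convex solution on `ℝⁿ` of the Kähler–Einstein equation
`e^{-Φ} = det D²Φ`. -/
structure IsPotential {n : ℕ} (Φ : EuclideanSpace ℝ (Fin n) → ℝ) : Prop where
  contDiff : ContDiff ℝ ∞ Φ
  convexOn : ConvexOn ℝ Set.univ Φ
  equation : ∀ x, Real.exp (-Φ x) = (hessianMatrix Φ x).det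

/-- The weighted Laplacian `(L u)(x) = Φ^{ij}(x) u_{ij}(x)`, where `(Φ^{ij})` is the inverse
of the Hessian matrix of `Φ`. -/
def weightedLaplacian {n : ℕ} (Φ u : EuclideanSpace ℝ (Fin n) → ℝ)
    (x : EuclideanSpace ℝ (Fin n)) : ℝ :=
  ∑ i, ∑ j, (hessianMatrix Φ x)⁻¹ i j * hessianMatrix u x i j

/-- The tangent vectors at `x` of length one for the Hessian metric `h = D²Φ`. -/
def unitVectors {n : ℕ} (Φ : EuclideanSpace ℝ (Fin n) → ℝ)
    (x : EuclideanSpace ℝ (Fin n)) : Set (EuclideanSpace ℝ (Fin n)) :=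
  {e | iteratedFDeriv ℝ 2 Φ x ![e, e] = 1}

/-- The values `Φ_{eee}(x)`, where `e` runs over the Riemannian unit vectors at `x`. -/
def thirdDerivValues {n : ℕ} (Φ : EuclideanSpace ℝ (Fin n) → ℝ)
    (x : EuclideanSpace ℝ (Fin n)) : Set ℝ :=
  (fun e => iteratedFDeriv ℝ 3 Φ x ![e, e, e]) '' unitVectors Φ x

/-- `f(x) = max_{|e| = 1} Φ_{eee}(x)`. -/
def maxThirdDeriv {n : ℕ} (Φ : EuclideanSpace ℝ (Fin n) → ℝ)
    (x : EuclideanSpace ℝ (Fin n)) : ℝ :=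
  sSup (thirdDerivValues Φ x)

/-- `L f ≥ F` on `ℝⁿ` in the barrier sense: `f` is continuous, and at every point `x₀` some
function `φ` that is smooth near `x₀` touches `f` from below at `x₀` and satisfies
`(L φ)(x₀) ≥ F(x₀)`. -/
def LaplacianGeInBarrierSense {n : ℕ} (Φ f F : EuclideanSpace ℝ (Fin n) → ℝ) : Prop :=
  Continuous f ∧
    ∀ x₀, ∃ U : Set (EuclideanSpace ℝ (Fin n)), IsOpen U ∧ x₀ ∈ U ∧
      ∃ φ : EuclideanSpace ℝ (Fin n) → ℝ, ContDiffOn ℝ ∞ φ U ∧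
        (∀ x ∈ U, φ x ≤ f x) ∧ φ x₀ = f x₀ ∧ F x₀ ≤ weightedLaplacian Φ φ x₀

end KahlerEinstein

end

/-! Fix `x₀` and a unit vector `e` attaining the maximum. Extend `e` to the affine field `ε` whose
first derivative at `x₀` is that of parallel transport. The Hessian metric has Christoffel symbols
Φ^{kl}Φ_{lij}/2, so ∂_y ε = -a(y)/2, where a is the h-symmetric operator with h(a(y), z) = Φ_{eyz}.
The barrier is φ(x) = Φ_{εεε} Φ_{εε}^{-3/2}. It is at most `f`, because the quotient is homogeneous
of degree zero in the direction.

The choice of `ε` kills the first derivative of Φ_{εε} at `x₀`, so φ'' is short (`d2_barrier`).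
Summed over an orthonormal frame, the fourth and fifth derivatives of Φ become traces.
Differentiating log det D²Φ = -Φ two and three times along `e` evaluates these traces
(`trace_identities`). The mixed products of third and fourth derivatives cancel, leaving Lφ = f/2 +
(3/4) f tr a² - (1/2) tr a³.

Maximality of `e` (`conditions_of_isMax`) makes `e` an eigenvector of a with eigenvalue f, and gives
a ≤ f/2 as a quadratic form on its orthogonal complement. The direction `e` contributes f³/4, and
the others contribute something nonnegative (`barrier_sum_ge`). -/

namespace KahlerEinstein

/-! ### Derivatives of determinants and inverses along matrix curves -/

section MatrixCurves

variable {ι : Type*} [Fintype ι]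

open scoped Matrix.Norms.Operator

/-- Jacobi's formula for the derivative of a determinant. -/
theorem hasDerivAt_det [DecidableEq ι] {g : ℝ → Matrix ι ι ℝ} {g' : Matrix ι ι ℝ} {t : ℝ}
    (hg : ∀ i j, HasDerivAt (fun s => g s i j) (g' i j) t) :
    HasDerivAt (fun s => (g s).det) ((g t).adjugate * g').trace t := by
  -- By Cramer's rule the trace is the sum of the determinants with one column differentiated, which
  -- is the product rule in the Leibniz expansion.
  have hsum : ((g t).adjugate * g').trace
      = ∑ i, ((g t).updateCol i (fun a => g' a i)).det := by
    simp only [Matrix.trace, Matrix.diag_apply]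
    refine Finset.sum_congr rfl fun i _ => ?_
    rw [← Matrix.cramer_apply, Matrix.cramer_eq_adjugate_mulVec]
    rfl
  rw [hsum]
  simp only [Matrix.det_apply]
  rw [Finset.sum_comm]
  refine HasDerivAt.fun_sum fun σ _ => ?_
  rw [← Finset.smul_sum]
  refine HasDerivAt.fun_const_smul _ ?_
  refine (HasDerivAt.fun_finsetProd (u := Finset.univ) (f := fun i s => g s (σ i) i)
    (fun i _ => hg (σ i) i)).congr_deriv ?_
  refine Finset.sum_congr rfl fun i _ => ?_
  rw [← Finset.mul_prod_erase _ _ (Finset.mem_univ i), smul_eq_mul, mul_comm]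
  congr 1
  · simp
  · refine Finset.prod_congr rfl fun j hj => ?_
    rw [Matrix.updateCol_ne (Finset.ne_of_mem_erase hj)]

theorem hasDerivAt_of_entries {g : ℝ → Matrix ι ι ℝ} {g' : Matrix ι ι ℝ} {t : ℝ}
    (hg : ∀ i j, HasDerivAt (fun s => g s i j) (g' i j) t) : HasDerivAt g g' t := by
  have h : HasDerivAt (fun s => (g s : ι → ι → ℝ)) (g' : ι → ι → ℝ) t :=
    hasDerivAt_pi.2 fun i => hasDerivAt_pi.2 fun j => hg i j
  exact h

theorem HasDerivAt.matrix_trace {g : ℝ → Matrix ι ι ℝ} {g' : Matrix ι ι ℝ} {t : ℝ}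
    (hg : HasDerivAt g g' t) : HasDerivAt (fun s => (g s).trace) g'.trace t := by
  exact (LinearMap.toContinuousLinearMap
    (Matrix.traceLinearMap ι ℝ ℝ)).hasFDerivAt.comp_hasDerivAt t hg

theorem HasDerivAt.matrix_inv [DecidableEq ι] {g : ℝ → Matrix ι ι ℝ} {g' : Matrix ι ι ℝ} {t : ℝ}
    (hg : HasDerivAt g g' t) (hu : IsUnit (g t)) :
    HasDerivAt (fun s => (g s)⁻¹) (-((g t)⁻¹ * g' * (g t)⁻¹)) t := by
  obtain ⟨u, hu⟩ := hu
  have h := hasFDerivAt_ringInverse (𝕜 := ℝ) u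
  rw [hu] at h
  have := h.comp_hasDerivAt t hg
  have hv : (g t)⁻¹ = ((u⁻¹ : (Matrix ι ι ℝ)ˣ) : Matrix ι ι ℝ) := by
    rw [← hu, Matrix.nonsing_inv_eq_ringInverse, Ring.inverse_unit]
  simp only [hv]
  simp only [Matrix.nonsing_inv_eq_ringInverse]
  exact this

/-- The traces of the second and third derivatives of a curve of matrices through the identity,
in terms of the logarithm of its determinant. -/
theorem trace_derivs_of_det_eq_exp [DecidableEq ι]
    {g g₁ g₂ g₃ : ℝ → Matrix ι ι ℝ} {p p₁ p₂ p₃ : ℝ → ℝ} {c : ℝ}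
    (hg : ∀ t i j, HasDerivAt (fun s => g s i j) (g₁ t i j) t)
    (hg₁ : ∀ t i j, HasDerivAt (fun s => g₁ s i j) (g₂ t i j) t)
    (hg₂ : ∀ t i j, HasDerivAt (fun s => g₂ s i j) (g₃ t i j) t)
    (hp : ∀ t, HasDerivAt p (p₁ t) t) (hp₁ : ∀ t, HasDerivAt p₁ (p₂ t) t)
    (hp₂ : ∀ t, HasDerivAt p₂ (p₃ t) t) (hc : c ≠ 0)
    (hdet : ∀ t, (g t).det = c * Real.exp (-p t)) (h0 : g 0 = 1) :
    (g₂ 0).trace = -p₂ 0 + (g₁ 0 * g₁ 0).trace ∧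
    (g₃ 0).trace = -p₃ 0 + 3 * (g₁ 0 * g₂ 0).trace - 2 * (g₁ 0 * g₁ 0 * g₁ 0).trace := by
  have hd : ∀ t, (g t).det ≠ 0 := fun t => by
    rw [hdet]; exact mul_ne_zero hc (Real.exp_ne_zero _)
  have hu : ∀ t, IsUnit (g t) := fun t => by
    rw [Matrix.isUnit_iff_isUnit_det]; exact (hd t).isUnit
  have hG := fun t => hasDerivAt_of_entries (hg t)
  have hG₁ := fun t => hasDerivAt_of_entries (hg₁ t)
  have hG₂ := fun t => hasDerivAt_of_entries (hg₂ t)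
  have hK := fun t => HasDerivAt.matrix_inv (hG t) (hu t)
  -- This is the logarithmic derivative of `hdet`. It holds for all `t`, so it can be differentiated
  -- twice more; only then is `g 0 = 1` used.
  have e₁ : ∀ t, ((g t)⁻¹ * g₁ t).trace = -p₁ t := by
    intro t
    have h1 := hasDerivAt_det (hg t)
    have h2 : HasDerivAt (fun s => (g s).det) (c * (Real.exp (-p t) * -p₁ t)) t := by
      simp only [hdet]
      exact ((hp t).neg.exp).const_mul c
    have h3 := h1.unique h2
    rw [← mul_assoc, ← hdet] at h3
    rw [Matrix.inv_def, Matrix.smul_mul, Matrix.trace_smul, h3, smul_eq_mul, Ring.inverse_eq_inv',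
      inv_mul_cancel_left₀ (hd t)]
  have e₂ : ∀ t, (-((g t)⁻¹ * g₁ t * (g t)⁻¹) * g₁ t + (g t)⁻¹ * g₂ t).trace = -p₂ t := by
    intro t
    have h1 := HasDerivAt.matrix_trace ((hK t).mul (hG₁ t))
    exact h1.unique ((hp₁ t).neg.congr_of_eventuallyEq (.of_forall e₁))
  have e₃ := HasDerivAt.matrix_trace
    ((((((hK 0).mul (hG₁ 0)).mul (hK 0)).neg).mul (hG₁ 0)).add ((hK 0).mul (hG₂ 0)))
  have e₃' := e₃.unique ((hp₂ 0).neg.congr_of_eventuallyEq (.of_forall e₂))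
  have e₂' := e₂ 0
  constructor
  · simp [h0, Matrix.trace_add] at e₂'
    linarith
  · simp [h0, Matrix.trace_add, add_mul] at e₃'
    have := Matrix.trace_mul_comm (g₂ 0) (g₁ 0)
    linarith

end MatrixCurves

/-! ### Higher derivatives as symmetric multilinear forms -/

section Derivatives

set_option synthInstance.maxHeartbeats 200000
set_option maxSynthPendingDepth 3

variable {E : Type*} [NormedAddCommGroup E] [NormedSpace ℝ E]

/-- The second derivative as a bilinear form. -/
noncomputable def d2 (u : E → ℝ) : E → E →L[ℝ] E →L[ℝ] ℝ := fderiv ℝ (fderiv ℝ u)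

/-- The third derivative as a trilinear form. -/
noncomputable def d3 (u : E → ℝ) : E → E →L[ℝ] E →L[ℝ] E →L[ℝ] ℝ := fderiv ℝ (d2 u)

/-- The fourth derivative as a quadrilinear form. -/
noncomputable def d4 (u : E → ℝ) : E → E →L[ℝ] E →L[ℝ] E →L[ℝ] E →L[ℝ] ℝ := fderiv ℝ (d3 u)

/-- The fifth derivative as a multilinear form. -/
noncomputable def d5 (u : E → ℝ) : E → E →L[ℝ] E →L[ℝ] E →L[ℝ] E →L[ℝ] E →L[ℝ] ℝ :=
  fderiv ℝ (d4 u)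

theorem iteratedFDeriv_two_eq (u : E → ℝ) (x v w : E) :
    iteratedFDeriv ℝ 2 u x ![v, w] = d2 u x v w := by
  simp [iteratedFDeriv_two_apply, d2]

theorem iteratedFDeriv_three_eq (u : E → ℝ) (x v w z : E) :
    iteratedFDeriv ℝ 3 u x ![v, w, z] = d3 u x v w z := by
  rw [iteratedFDeriv_succ_apply_right, iteratedFDeriv_two_apply]
  rfl

theorem hasDerivAt_comp_line {F : Type*} [NormedAddCommGroup F] [NormedSpace ℝ F] {u : E → F}
    (hu : Differentiable ℝ u) (x y : E) (t : ℝ) :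
    HasDerivAt (fun s : ℝ => u (x + s • y)) (fderiv ℝ u (x + t • y) y) t := by
  have h : HasDerivAt (fun s : ℝ => x + s • y) y t := by
    simpa using ((hasDerivAt_id t).smul_const y).const_add x
  exact (hu (x + t • y)).hasFDerivAt.comp_hasDerivAt t h

theorem fderiv_fderiv_swap {F : Type*} [NormedAddCommGroup F] [NormedSpace ℝ F] {u : E → F}
    (hu : ContDiff ℝ ∞ u) (x v w : E) :
    fderiv ℝ (fderiv ℝ u) x v w = fderiv ℝ (fderiv ℝ u) x w v :=
  (hu.contDiffAt.isSymmSndFDerivAt 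
    (by simpa using (WithTop.coe_le_coe.2 le_top : ((2 : ℕ∞) : WithTop ℕ∞) ≤ ((⊤ : ℕ∞) : WithTop ℕ∞)))).eq v w

variable {Φ : E → ℝ} (hΦ : ContDiff ℝ ∞ Φ)
include hΦ

theorem contDiff_fderiv_infty : ContDiff ℝ ∞ (fderiv ℝ Φ) := hΦ.fderiv_right (by simp)

theorem contDiff_d2 : ContDiff ℝ ∞ (d2 Φ) := (contDiff_fderiv_infty hΦ).fderiv_right (by simp)

theorem contDiff_d3 : ContDiff ℝ ∞ (d3 Φ) := (contDiff_d2 hΦ).fderiv_right (by simp)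

theorem contDiff_d4 : ContDiff ℝ ∞ (d4 Φ) := (contDiff_d3 hΦ).fderiv_right (by simp)

theorem hasDerivAt_line (x y : E) (t : ℝ) :
    HasDerivAt (fun s : ℝ => Φ (x + s • y)) (fderiv ℝ Φ (x + t • y) y) t :=
  hasDerivAt_comp_line (hΦ.differentiable (by simp)) x y t

theorem hasDerivAt_fderiv_line (x y : E) (t : ℝ) :
    HasDerivAt (fun s : ℝ => fderiv ℝ Φ (x + s • y)) (d2 Φ (x + t • y) y) t :=
  hasDerivAt_comp_line ((contDiff_fderiv_infty hΦ).differentiable (by simp)) x y t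

theorem hasDerivAt_d2_line (x y : E) (t : ℝ) :
    HasDerivAt (fun s : ℝ => d2 Φ (x + s • y)) (d3 Φ (x + t • y) y) t :=
  hasDerivAt_comp_line ((contDiff_d2 hΦ).differentiable (by simp)) x y t

theorem hasDerivAt_d3_line (x y : E) (t : ℝ) :
    HasDerivAt (fun s : ℝ => d3 Φ (x + s • y)) (d4 Φ (x + t • y) y) t :=
  hasDerivAt_comp_line ((contDiff_d3 hΦ).differentiable (by simp)) x y t

theorem hasDerivAt_d4_line (x y : E) (t : ℝ) :
    HasDerivAt (fun s : ℝ => d4 Φ (x + s • y)) (d5 Φ (x + t • y) y) t :=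
  hasDerivAt_comp_line ((contDiff_d4 hΦ).differentiable (by simp)) x y t

theorem hasDerivAt_d2_moving (x y : E) {a b : ℝ → E} {a' b' : E} {t : ℝ}
    (ha : HasDerivAt a a' t) (hb : HasDerivAt b b' t) :
    HasDerivAt (fun s : ℝ => d2 Φ (x + s • y) (a s) (b s))
      (d3 Φ (x + t • y) y (a t) (b t) + d2 Φ (x + t • y) a' (b t)
        + d2 Φ (x + t • y) (a t) b') t := by
  simpa using ((hasDerivAt_d2_line hΦ x y t).clm_apply ha).clm_apply hb

theorem hasDerivAt_d3_moving (x y : E) {a b c : ℝ → E} {a' b' c' : E} {t : ℝ}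
    (ha : HasDerivAt a a' t) (hb : HasDerivAt b b' t) (hc : HasDerivAt c c' t) :
    HasDerivAt (fun s : ℝ => d3 Φ (x + s • y) (a s) (b s) (c s))
      (d4 Φ (x + t • y) y (a t) (b t) (c t) + d3 Φ (x + t • y) a' (b t) (c t)
        + d3 Φ (x + t • y) (a t) b' (c t) + d3 Φ (x + t • y) (a t) (b t) c') t := by
  simpa using (((hasDerivAt_d3_line hΦ x y t).clm_apply ha).clm_apply hb).clm_apply hc

theorem hasDerivAt_d4_moving (x y : E) {a b c d : ℝ → E} {a' b' c' d' : E} {t : ℝ}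
    (ha : HasDerivAt a a' t) (hb : HasDerivAt b b' t) (hc : HasDerivAt c c' t)
    (hd : HasDerivAt d d' t) :
    HasDerivAt (fun s : ℝ => d4 Φ (x + s • y) (a s) (b s) (c s) (d s))
      (d5 Φ (x + t • y) y (a t) (b t) (c t) (d t) + d4 Φ (x + t • y) a' (b t) (c t) (d t)
        + d4 Φ (x + t • y) (a t) b' (c t) (d t) + d4 Φ (x + t • y) (a t) (b t) c' (d t)
        + d4 Φ (x + t • y) (a t) (b t) (c t) d') t := by
  simpa using ((((hasDerivAt_d4_line hΦ x y t).clm_apply ha).clm_apply hb).clm_apply hc).clm_apply hd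

theorem hasDerivAt_d2_line_apply (x y a b : E) (t : ℝ) :
    HasDerivAt (fun s : ℝ => d2 Φ (x + s • y) a b) (d3 Φ (x + t • y) y a b) t := by
  simpa using hasDerivAt_d2_moving hΦ x y (hasDerivAt_const t a) (hasDerivAt_const t b)

theorem hasDerivAt_d3_line_apply (x y a b c : E) (t : ℝ) :
    HasDerivAt (fun s : ℝ => d3 Φ (x + s • y) a b c) (d4 Φ (x + t • y) y a b c) t := by
  simpa using hasDerivAt_d3_moving hΦ x y (hasDerivAt_const t a) (hasDerivAt_const t b)
    (hasDerivAt_const t c)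

theorem hasDerivAt_d4_line_apply (x y a b c d : E) (t : ℝ) :
    HasDerivAt (fun s : ℝ => d4 Φ (x + s • y) a b c d) (d5 Φ (x + t • y) y a b c d) t := by
  simpa using hasDerivAt_d4_moving hΦ x y (hasDerivAt_const t a) (hasDerivAt_const t b)
    (hasDerivAt_const t c) (hasDerivAt_const t d)

theorem d2_swap (x a b : E) : d2 Φ x a b = d2 Φ x b a := fderiv_fderiv_swap hΦ x a b

theorem d3_swap₁ (x a b c : E) : d3 Φ x a b c = d3 Φ x b a c :=
  congrArg (· c) (fderiv_fderiv_swap (contDiff_fderiv_infty hΦ) x a b)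

/-- Symmetry in the later slots is inherited by differentiating the lower-order symmetry along a
line; only the first two slots need Schwarz's theorem. -/
theorem d3_swap₂ (x a b c : E) : d3 Φ x a b c = d3 Φ x a c b := by
  have h1 := hasDerivAt_d2_line_apply hΦ x a b c 0
  simp only [d2_swap hΦ _ b c] at h1
  simpa using h1.unique (hasDerivAt_d2_line_apply hΦ x a c b 0)

theorem d4_swap₁ (x a b c d : E) : d4 Φ x a b c d = d4 Φ x b a c d :=
  congrArg (· c d) (fderiv_fderiv_swap (contDiff_d2 hΦ) x a b)

theorem d4_swap₂ (x a b c d : E) : d4 Φ x a b c d = d4 Φ x a c b d := by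
  have h1 := hasDerivAt_d3_line_apply hΦ x a b c d 0
  simp only [d3_swap₁ hΦ _ b c] at h1
  simpa using h1.unique (hasDerivAt_d3_line_apply hΦ x a c b d 0)

theorem d4_swap₃ (x a b c d : E) : d4 Φ x a b c d = d4 Φ x a b d c := by
  have h1 := hasDerivAt_d3_line_apply hΦ x a b c d 0
  simp only [d3_swap₂ hΦ _ b c] at h1
  simpa using h1.unique (hasDerivAt_d3_line_apply hΦ x a b d c 0)

theorem d5_swap₁ (x a b c d e : E) : d5 Φ x a b c d e = d5 Φ x b a c d e :=
  congrArg (· c d e) (fderiv_fderiv_swap (contDiff_d3 hΦ) x a b)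

theorem d5_congr {x b c d e b' c' d' e' : E} (h : ∀ z, d4 Φ z b c d e = d4 Φ z b' c' d' e')
    (a : E) : d5 Φ x a b c d e = d5 Φ x a b' c' d' e' := by
  have h1 := hasDerivAt_d4_line_apply hΦ x a b c d e 0
  simp only [h] at h1
  simpa using h1.unique (hasDerivAt_d4_line_apply hΦ x a b' c' d' e' 0)

theorem d4_rotate (x a b c d : E) : d4 Φ x a b c d = d4 Φ x c d a b := by
  rw [d4_swap₂ hΦ, d4_swap₁ hΦ, d4_swap₃ hΦ, d4_swap₂ hΦ]

/-- Puts the frame directions last, where the trace identities expect them. -/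
theorem d5_rotate (x a b c d e : E) : d5 Φ x a b c d e = d5 Φ x c d e a b := by
  rw [d5_congr hΦ (fun z => (d4_swap₁ hΦ z b c d e).trans (d4_swap₂ hΦ z c b d e)) a,
    d5_congr hΦ (fun z => d4_swap₃ hΦ z c d b e) a, d5_swap₁ hΦ,
    d5_congr hΦ (fun z => (d4_swap₁ hΦ z a d e b).trans (d4_swap₂ hΦ z d a e b)) c]

/-- The second derivative of a convex function is nonnegative. -/
theorem d2_nonneg_of_convexOn (hc : ConvexOn ℝ Set.univ Φ) (x v : E) : 0 ≤ d2 Φ x v v := by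
  have hconv : ConvexOn ℝ Set.univ (fun s : ℝ => Φ (x + s • v)) := by
    have := hc.comp_affineMap (AffineMap.lineMap x (x + v))
    simpa [Function.comp_def, AffineMap.lineMap_apply, add_comm] using this
  have hd := hasDerivAt_line hΦ x v
  have hderiv : deriv (fun s : ℝ => Φ (x + s • v)) = fun s => fderiv ℝ Φ (x + s • v) v :=
    funext fun s => (hd s).deriv
  have hmono := hconv.monotoneOn_deriv fun t _ => (hd t).differentiableAt
  rw [monotoneOn_univ, hderiv] at hmono
  have h2 := ((hasDerivAt_fderiv_line hΦ x v 0).clm_apply (hasDerivAt_const 0 v)).deriv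
  have := hmono.deriv_nonneg (x := 0)
  rw [h2] at this
  simpa using this

end Derivatives

/-- A positive definite matrix has a unit frame whose member of index `i₀` is prescribed. -/
theorem exists_frame {n : ℕ} {H : Matrix (Fin n) (Fin n) ℝ} (hH : H.PosDef) (i₀ : Fin n)
    {v : Fin n → ℝ} (hv : v ⬝ᵥ H.mulVec v = 1) :
    ∃ P : Matrix (Fin n) (Fin n) ℝ, P.transpose * H * P = 1 ∧ P.col i₀ = v := by
  -- `R` is an isometry from the form `H` to the Euclidean one. The unit vector `Rv` is completed to
  -- an orthonormal basis there and pulled back by `R⁻¹`.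
  obtain ⟨R, hR, hRH⟩ : ∃ R : Matrix (Fin n) (Fin n) ℝ, IsUnit R ∧ H = R.transpose * R := by
    open scoped Matrix.Norms.L2Operator MatrixOrder in
    obtain ⟨R, hR⟩ := CStarAlgebra.nonneg_iff_eq_star_mul_self.mp hH.posSemidef.nonneg
    have hR' : H = R.transpose * R := by
      rw [hR, Matrix.star_eq_conjTranspose, Matrix.conjTranspose_eq_transpose_of_trivial]
    refine ⟨R, ?_, hR'⟩
    rw [Matrix.isUnit_iff_isUnit_det]
    have := hH.det_pos.ne'
    rw [hR', Matrix.det_mul] at this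
    exact (right_ne_zero_of_mul this).isUnit
  have hRd : IsUnit R.det := (Matrix.isUnit_iff_isUnit_det R).1 hR
  set r : EuclideanSpace ℝ (Fin n) := WithLp.toLp 2 (R.mulVec v)
  have hrr : inner ℝ r r = (1 : ℝ) := by
    rw [← hv, hRH, ← Matrix.mulVec_mulVec, Matrix.dotProduct_mulVec, Matrix.vecMul_transpose]
    rw [EuclideanSpace.inner_eq_star_dotProduct]
    rfl
  have hon : Orthonormal ℝ (({i₀} : Set (Fin n)).domRestrict fun _ => r) := by
    rw [orthonormal_iff_ite]
    intro i j
    have : i = j := Subsingleton.elim i j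
    simp only [this, if_true]
    exact hrr
  obtain ⟨c, hc⟩ := hon.exists_orthonormalBasis_extension_of_card_eq (by simp)
  have hc0 : c i₀ = r := hc i₀ rfl
  set C : Matrix (Fin n) (Fin n) ℝ := Matrix.of fun i j => c j i
  have hC : C.transpose * C = 1 := by
    ext i j
    have := orthonormal_iff_ite.1 c.orthonormal j i
    rw [Matrix.one_apply]
    simp only [eq_comm (a := i) (b := j)]
    rw [← this]
    simp [Matrix.mul_apply, C, EuclideanSpace.inner_eq_star_dotProduct, dotProduct]
  refine ⟨R⁻¹ * C, ?_, ?_⟩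
  · rw [Matrix.transpose_mul, hRH, Matrix.transpose_nonsing_inv]
    have h1 : R * (R⁻¹ * C) = C := by rw [← mul_assoc, Matrix.mul_nonsing_inv _ hRd, one_mul]
    have h2 : (R.transpose)⁻¹ * R.transpose = 1 :=
      Matrix.nonsing_inv_mul _ (by rwa [Matrix.det_transpose])
    calc C.transpose * (R.transpose)⁻¹ * (R.transpose * R) * (R⁻¹ * C)
        = C.transpose * ((R.transpose)⁻¹ * R.transpose) * (R * (R⁻¹ * C)) := by
          simp only [mul_assoc]
      _ = 1 := by rw [h1, h2, mul_one, hC]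
  · have : (R⁻¹ * C).col i₀ = R⁻¹.mulVec (C.col i₀) := rfl
    rw [this]
    have : C.col i₀ = R.mulVec v := by
      ext i
      simp [C, hc0, r]
    rw [this, Matrix.mulVec_mulVec, Matrix.nonsing_inv_mul _ hRd, Matrix.one_mulVec]

/-! ### The Hessian metric and the maximal third derivative -/

section Potential

set_option synthInstance.maxHeartbeats 200000
set_option maxSynthPendingDepth 3

variable {n : ℕ}

theorem hessianMatrix_apply (u : EuclideanSpace ℝ (Fin n) → ℝ) (x : EuclideanSpace ℝ (Fin n))
    (i j : Fin n) : hessianMatrix u x i j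
      = d2 u x (EuclideanSpace.single i 1) (EuclideanSpace.single j 1) := by
  simp [hessianMatrix, iteratedFDeriv_two_eq]

theorem d2_eq_dotProduct (u : EuclideanSpace ℝ (Fin n) → ℝ) (x v w : EuclideanSpace ℝ (Fin n)) :
    d2 u x v w = v.ofLp ⬝ᵥ (hessianMatrix u x).mulVec w.ofLp := by
  have hsum : ∀ z : EuclideanSpace ℝ (Fin n), z = ∑ i, z.ofLp i • EuclideanSpace.single i 1 := by
    intro z
    ext j
    simp [Finset.sum_apply, Pi.single_apply]
  conv_lhs => rw [hsum v, hsum w]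
  simp [dotProduct, Matrix.mulVec, hessianMatrix_apply, Finset.mul_sum]
  rw [Finset.sum_comm]
  exact Finset.sum_congr rfl fun i _ => Finset.sum_congr rfl fun j _ => by ring

namespace IsPotential

variable {Φ : EuclideanSpace ℝ (Fin n) → ℝ} (hΦ : IsPotential Φ)
include hΦ

/-- Convexity gives only semidefiniteness; the equation makes the determinant an exponential, hence
nonzero. -/
theorem posDef_hessianMatrix (x : EuclideanSpace ℝ (Fin n)) : (hessianMatrix Φ x).PosDef := by
  have hs : (hessianMatrix Φ x).PosSemidef := by
    refine .of_dotProduct_mulVec_nonneg ?_ fun v => ?_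
    · ext i j
      simp [hessianMatrix_apply, d2_swap hΦ.contDiff x (EuclideanSpace.single i 1)]
    · have := d2_nonneg_of_convexOn hΦ.contDiff hΦ.convexOn x (WithLp.toLp 2 v)
      rw [d2_eq_dotProduct] at this
      simpa using this
  rw [hs.posDef_iff_det_ne_zero, ← hΦ.equation]
  exact Real.exp_ne_zero _

theorem d2_pos (x : EuclideanSpace ℝ (Fin n)) {v : EuclideanSpace ℝ (Fin n)} (hv : v ≠ 0) :
    0 < d2 Φ x v v := by
  have hv' : v.ofLp ≠ 0 := by simpa using hv
  have := (hΦ.posDef_hessianMatrix x).dotProduct_mulVec_pos hv'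
  rw [d2_eq_dotProduct]
  simpa using this

end IsPotential

/-- The third derivative in the direction `e`, normalized by the Riemannian length of `e`. -/
noncomputable def normalizedThird (Φ : EuclideanSpace ℝ (Fin n) → ℝ)
    (x e : EuclideanSpace ℝ (Fin n)) : ℝ :=
  d3 Φ x e e e * d2 Φ x e e ^ (-(3 / 2) : ℝ)

theorem normalizedThird_smul (Φ : EuclideanSpace ℝ (Fin n) → ℝ)
    (x e : EuclideanSpace ℝ (Fin n)) {c : ℝ} (hc : 0 < c) (he : 0 < d2 Φ x e e) :
    normalizedThird Φ x (c • e) = normalizedThird Φ x e := by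
  have h1 : d2 Φ x (c • e) (c • e) = c ^ 2 * d2 Φ x e e := by simp; ring
  have h2 : d3 Φ x (c • e) (c • e) (c • e) = c ^ 3 * d3 Φ x e e e := by simp; ring
  have h3 : (c ^ 2) ^ (-(3 / 2) : ℝ) = (c ^ 3)⁻¹ := by
    rw [← Real.rpow_natCast, ← Real.rpow_natCast, ← Real.rpow_mul hc.le, ← Real.rpow_neg hc.le]
    norm_num
  rw [normalizedThird, h1, h2, Real.mul_rpow (by positivity) he.le, h3, normalizedThird]
  field_simp

theorem normalizedThird_of_unit {Φ : EuclideanSpace ℝ (Fin n) → ℝ}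
    {x e : EuclideanSpace ℝ (Fin n)} (he : d2 Φ x e e = 1) :
    normalizedThird Φ x e = d3 Φ x e e e := by
  simp [normalizedThird, he]

theorem normalizedThird_mem {Φ : EuclideanSpace ℝ (Fin n) → ℝ}
    {x e : EuclideanSpace ℝ (Fin n)} (he : 0 < d2 Φ x e e) :
    normalizedThird Φ x e ∈ thirdDerivValues Φ x := by
  have hs : 0 < √(d2 Φ x e e) := Real.sqrt_pos.2 he
  have hu : d2 Φ x ((√(d2 Φ x e e))⁻¹ • e) ((√(d2 Φ x e e))⁻¹ • e) = 1 := by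
    simp only [map_smul, smul_apply, smul_eq_mul]
    rw [← mul_assoc, ← mul_inv, Real.mul_self_sqrt he.le, inv_mul_cancel₀ he.ne']
  refine ⟨(√(d2 Φ x e e))⁻¹ • e, ?_, ?_⟩
  · rw [unitVectors, Set.mem_ofPred_eq, iteratedFDeriv_two_eq, hu]
  · simp only [iteratedFDeriv_three_eq]
    rw [← normalizedThird_of_unit hu, normalizedThird_smul _ _ _ (inv_pos.2 hs) he]

namespace IsPotential

variable {Φ : EuclideanSpace ℝ (Fin n) → ℝ} (hΦ : IsPotential Φ)
include hΦ

/-- By homogeneity the Riemannian unit sphere, which varies with `x`, can be replaced by the fixed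
compact Euclidean one. Attainment and continuity of the maximum follow from this. -/
theorem thirdDerivValues_eq (x : EuclideanSpace ℝ (Fin n)) :
    thirdDerivValues Φ x =
      (fun e : Metric.sphere (0 : EuclideanSpace ℝ (Fin n)) 1 => normalizedThird Φ x e) ''
        Set.univ := by
  ext r
  constructor
  · rintro ⟨e, he, rfl⟩
    rw [unitVectors, Set.mem_ofPred_eq, iteratedFDeriv_two_eq] at he
    have hne : e ≠ 0 := by rintro rfl; simp at he
    refine ⟨⟨‖e‖⁻¹ • e, ?_⟩, Set.mem_univ _, ?_⟩
    · simp [norm_smul, hne]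
    · simp only [iteratedFDeriv_three_eq]
      rw [normalizedThird_smul _ _ _ (by positivity) (by simp [he]), normalizedThird_of_unit he]
  · rintro ⟨e, -, rfl⟩
    exact normalizedThird_mem (hΦ.d2_pos x (ne_zero_of_mem_unit_sphere e))

theorem continuous_normalizedThird :
    Continuous fun p : EuclideanSpace ℝ (Fin n) × Metric.sphere (0 : EuclideanSpace ℝ (Fin n)) 1 =>
      normalizedThird Φ p.1 p.2 := by
  have h2 := (contDiff_d2 hΦ.contDiff).continuous
  have h3 := (contDiff_d3 hΦ.contDiff).continuous
  unfold normalizedThird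
  refine Continuous.mul (by fun_prop) (Continuous.rpow_const (by fun_prop) fun p => Or.inl ?_)
  exact (hΦ.d2_pos p.1 (ne_zero_of_mem_unit_sphere p.2)).ne'

theorem continuous_maxThirdDeriv : Continuous (maxThirdDeriv Φ) := by
  have : maxThirdDeriv Φ = fun x => sSup
      ((fun e : Metric.sphere (0 : EuclideanSpace ℝ (Fin n)) 1 => normalizedThird Φ x e) ''
        Set.univ) := funext fun x => by rw [maxThirdDeriv, hΦ.thirdDerivValues_eq]
  rw [this]
  exact isCompact_univ.continuous_sSup hΦ.continuous_normalizedThird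

theorem isGreatest_maxThirdDeriv (hn : 1 ≤ n) (x : EuclideanSpace ℝ (Fin n)) :
    IsGreatest (thirdDerivValues Φ x) (maxThirdDeriv Φ x) := by
  have : Nonempty (Fin n) := ⟨⟨0, hn⟩⟩
  have hne : (Metric.sphere (0 : EuclideanSpace ℝ (Fin n)) 1).Nonempty :=
    NormedSpace.sphere_nonempty.2 zero_le_one
  have : Nonempty (Metric.sphere (0 : EuclideanSpace ℝ (Fin n)) 1) := hne.to_subtype
  rw [maxThirdDeriv, hΦ.thirdDerivValues_eq]
  refine IsCompact.isGreatest_sSup (isCompact_univ.image ?_) (Set.univ_nonempty.image _)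
  exact hΦ.continuous_normalizedThird.comp (Continuous.prodMk_right x)

end IsPotential

/-- First- and second-order conditions for a cubic form at a maximum on a unit circle. -/
theorem cubic_conditions {f a b c : ℝ}
    (h : ∀ t : ℝ, f + 3 * t * a + 3 * t ^ 2 * b + t ^ 3 * c ≤ f * (1 + t ^ 2) ^ (3 / 2 : ℝ))
    (hf : 0 ≤ f) : a = 0 ∧ b ≤ f / 2 := by
  -- The Taylor polynomial in t² is an upper bound, so the hypothesis becomes a polynomial
  -- inequality.
  have hpow : ∀ t : ℝ, (1 + t ^ 2) ^ (3 / 2 : ℝ) ≤ 1 + 3 / 2 * t ^ 2 + 3 / 8 * t ^ 4 := by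
    intro t
    have h1 : ((1 + t ^ 2) ^ (3 / 2 : ℝ)) ^ 2 = (1 + t ^ 2) ^ 3 := by
      rw [← Real.rpow_natCast, ← Real.rpow_mul (by positivity), ← Real.rpow_natCast]
      norm_num
    refine le_of_sq_le_sq ?_ (by positivity)
    rw [h1]
    nlinarith [sq_nonneg (t ^ 3), sq_nonneg (t ^ 4)]
  have h' : ∀ t : ℝ, 0 ≤ -(3 * a) * t + (f * (3 / 2) - 3 * b) * t ^ 2 - c * t ^ 3
      + f * (3 / 8) * t ^ 4 := fun t => by
    nlinarith [h t, mul_le_mul_of_nonneg_left (hpow t) hf]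
  -- The lowest-order coefficient is isolated by dividing by a power of t and letting t → 0⁺;
  -- negative t supplies the opposite sign for the linear term.
  have key : ∀ {k : ℝ} {r : ℝ → ℝ}, Continuous r → (∀ t, 0 < t → 0 ≤ k + t * r t) → 0 ≤ k := by
    intro k r hr hk
    have hc : Filter.Tendsto (fun t => k + t * r t) (nhdsWithin 0 (Set.Ioi 0)) (nhds k) := by
      have : Continuous fun t => k + t * r t := by fun_prop
      simpa using (this.tendsto 0).mono_left nhdsWithin_le_nhds
    exact ge_of_tendsto hc (eventually_nhdsWithin_of_forall fun t ht => hk t ht)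
  have ha : a = 0 := by
    apply le_antisymm
    · have : 0 ≤ -(3 * a) := by
        refine key (r := fun t => (f * (3 / 2) - 3 * b) - c * t + f * (3 / 8) * t ^ 2)
          (by fun_prop) fun t ht => ?_
        have := h' t
        refine nonneg_of_mul_nonneg_right (a := t) ?_ ht
        nlinarith
      linarith
    · have : 0 ≤ 3 * a := by
        refine key (r := fun t => (f * (3 / 2) - 3 * b) + c * t + f * (3 / 8) * t ^ 2)
          (by fun_prop) fun t ht => ?_
        have := h' (-t)
        refine nonneg_of_mul_nonneg_right (a := t) ?_ ht
        nlinarith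
      linarith
  refine ⟨ha, ?_⟩
  have : 0 ≤ f * (3 / 2) - 3 * b := by
    refine key (r := fun t => - c + f * (3 / 8) * t) (by fun_prop) fun t ht => ?_
    have := h' t
    rw [ha] at this
    refine nonneg_of_mul_nonneg_right (a := t ^ 2) ?_ (by positivity)
    nlinarith
  linarith

end Potential

/-! ### Maximality conditions, trace identities and the second derivative of the barrier -/

section Barrier

set_option synthInstance.maxHeartbeats 200000
set_option maxSynthPendingDepth 3

variable {n : ℕ}

namespace IsPotential

variable {Φ : EuclideanSpace ℝ (Fin n) → ℝ} (hΦ : IsPotential Φ)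
include hΦ

theorem d3_le (hn : 1 ≤ n) (x : EuclideanSpace ℝ (Fin n)) {w : EuclideanSpace ℝ (Fin n)}
    (hw : 0 < d2 Φ x w w) :
    d3 Φ x w w w ≤ maxThirdDeriv Φ x * d2 Φ x w w ^ (3 / 2 : ℝ) := by
  have h := (hΦ.isGreatest_maxThirdDeriv hn x).2 (normalizedThird_mem hw)
  rw [normalizedThird, Real.rpow_neg hw.le, ← div_eq_mul_inv] at h
  exact (div_le_iff₀ (Real.rpow_pos_of_pos hw _)).1 h

/-- The cubic form is odd, so testing `-e` gives -f ≤ f. -/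
theorem maxThirdDeriv_nonneg (hn : 1 ≤ n) {x e : EuclideanSpace ℝ (Fin n)}
    (he : d2 Φ x e e = 1) (hmax : d3 Φ x e e e = maxThirdDeriv Φ x) : 0 ≤ maxThirdDeriv Φ x := by
  have h := hΦ.d3_le hn x (w := -e) (by simp [he])
  simp [he, hmax] at h
  linarith

/-- Conditions satisfied by a direction in which the third derivative is maximal. -/
theorem conditions_of_isMax (hn : 1 ≤ n) {x e : EuclideanSpace ℝ (Fin n)}
    (he : d2 Φ x e e = 1) (hmax : d3 Φ x e e e = maxThirdDeriv Φ x)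
    {v : EuclideanSpace ℝ (Fin n)} (hv : d2 Φ x e v = 0) :
    d3 Φ x e e v = 0 ∧ d3 Φ x e v v ≤ maxThirdDeriv Φ x / 2 * d2 Φ x v v := by
  rcases eq_or_ne v 0 with rfl | hne
  · simp
  have hm : 0 < d2 Φ x v v := hΦ.d2_pos x hne
  set s := (√(d2 Φ x v v))⁻¹ with hs
  have hs0 : 0 < s := inv_pos.2 (Real.sqrt_pos.2 hm)
  have hss : s ^ 2 * d2 Φ x v v = 1 := by
    rw [hs, inv_pow, Real.sq_sqrt hm.le, inv_mul_cancel₀ hm.ne']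
  have hve : d2 Φ x v e = 0 := by rw [d2_swap hΦ.contDiff, hv]
  have h := cubic_conditions (f := maxThirdDeriv Φ x) (a := s * d3 Φ x e e v)
    (b := s ^ 2 * d3 Φ x e v v) (c := s ^ 3 * d3 Φ x v v v) (fun t => ?_)
    (hΦ.maxThirdDeriv_nonneg hn he hmax)
  · refine ⟨by simpa [hs0.ne'] using h.1, ?_⟩
    have h2 := mul_le_mul_of_nonneg_right h.2 hm.le
    calc d3 Φ x e v v = s ^ 2 * d3 Φ x e v v * d2 Φ x v v := by
          rw [mul_right_comm, hss, one_mul]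
      _ ≤ _ := h2
  -- Since `s • v` is a unit vector orthogonal to `e`, `d3_le` on this line is exactly the
  -- hypothesis of `cubic_conditions`.
  · have hd2 : d2 Φ x (e + (t * s) • v) (e + (t * s) • v) = 1 + t ^ 2 := by
      simp only [map_add, map_smul, add_apply, smul_apply,
        smul_eq_mul, he, hv, hve]
      linear_combination t ^ 2 * hss
    have h := hΦ.d3_le hn x (w := e + (t * s) • v) (by rw [hd2]; positivity)
    rw [hd2] at h
    refine le_trans (le_of_eq ?_) h
    simp only [map_add, map_smul, add_apply, smul_apply,
      smul_eq_mul]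
    rw [d3_swap₁ hΦ.contDiff x v e, d3_swap₁ hΦ.contDiff x v e v, d3_swap₂ hΦ.contDiff x e v e,
      d3_swap₂ hΦ.contDiff x v v e, d3_swap₁ hΦ.contDiff x v e v, hmax]
    ring

/-- A frame that is orthonormal for the Hessian metric at `x`. -/
theorem exists_orthonormal_frame (i₀ : Fin n) {x e : EuclideanSpace ℝ (Fin n)}
    (he : d2 Φ x e e = 1) :
    ∃ b : Fin n → EuclideanSpace ℝ (Fin n), b i₀ = e ∧
      (∀ i j, d2 Φ x (b i) (b j) = if i = j then 1 else 0) ∧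
      (∀ u, weightedLaplacian Φ u x = ∑ k, d2 u x (b k) (b k)) ∧
      ∃ c : ℝ, c ≠ 0 ∧ ∀ z, (Matrix.of fun i j => d2 Φ z (b i) (b j)).det = c * Real.exp (-Φ z) := by
  rw [d2_eq_dotProduct] at he
  obtain ⟨P, hP, hPe⟩ := exists_frame (hΦ.posDef_hessianMatrix x) i₀ he
  have hgram : ∀ (u : EuclideanSpace ℝ (Fin n) → ℝ) z i j,
      d2 u z (WithLp.toLp 2 (P.col i)) (WithLp.toLp 2 (P.col j))
        = (P.transpose * hessianMatrix u z * P) i j := by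
    intro u z i j
    rw [d2_eq_dotProduct, mul_assoc]
    rfl
  -- The frame is constant in `z`, so passing to it multiplies the Hessian determinant by the
  -- constant (det P)² at every point.
  refine ⟨fun i => WithLp.toLp 2 (P.col i), ?_, ?_, ?_, P.det ^ 2, ?_, ?_⟩
  · simp [hPe]
  · intro i j
    rw [hgram, hP, Matrix.one_apply]
  · intro u
    have hinv : (hessianMatrix Φ x)⁻¹ = P * P.transpose := by
      refine Matrix.inv_eq_left_inv ?_
      rw [mul_assoc, mul_eq_one_comm, hP]
    simp only [hgram]
    have h1 : ∑ k, (P.transpose * hessianMatrix u x * P) k k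
        = (P.transpose * hessianMatrix u x * P).trace := rfl
    rw [h1, Matrix.trace_mul_comm, ← mul_assoc, ← hinv, weightedLaplacian]
    have hsymm : ((hessianMatrix Φ x)⁻¹).transpose = (hessianMatrix Φ x)⁻¹ := by
      rw [hinv, Matrix.transpose_mul, Matrix.transpose_transpose]
    refine Finset.sum_comm.trans (Finset.sum_congr rfl fun j _ => ?_)
    rw [Matrix.diag_apply, Matrix.mul_apply]
    refine Finset.sum_congr rfl fun i _ => ?_
    rw [← congrFun (congrFun hsymm j) i, Matrix.transpose_apply]
  · have h := congrArg Matrix.det hP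
    rw [Matrix.det_mul, Matrix.det_one] at h
    exact pow_ne_zero _ (right_ne_zero_of_mul (h.trans_ne one_ne_zero))
  · intro z
    have : (Matrix.of fun i j => d2 Φ z (WithLp.toLp 2 (P.col i)) (WithLp.toLp 2 (P.col j)))
        = P.transpose * hessianMatrix Φ z * P := by
      ext i j
      exact hgram Φ z i j
    rw [this, Matrix.det_mul, Matrix.det_mul, Matrix.det_transpose, ← hΦ.equation]
    ring

end IsPotential

/-- The Kähler–Einstein equation differentiated two and three times in a direction `e`, expressed
in a unit frame. -/
theorem trace_identities {Φ : EuclideanSpace ℝ (Fin n) → ℝ} (hΦ : ContDiff ℝ ∞ Φ)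
    {x e : EuclideanSpace ℝ (Fin n)} {b : Fin n → EuclideanSpace ℝ (Fin n)} {c : ℝ} (hc : c ≠ 0)
    (hb : ∀ i j, d2 Φ x (b i) (b j) = if i = j then 1 else 0)
    (hdet : ∀ z, (Matrix.of fun i j => d2 Φ z (b i) (b j)).det = c * Real.exp (-Φ z)) :
    (∑ k, d4 Φ x e e (b k) (b k)
      = -d2 Φ x e e + ∑ k, ∑ j, d3 Φ x e (b k) (b j) * d3 Φ x e (b j) (b k)) ∧
    (∑ k, d5 Φ x e e e (b k) (b k) = -d3 Φ x e e e
      + 3 * ∑ k, ∑ j, d3 Φ x e (b k) (b j) * d4 Φ x e e (b j) (b k)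
      - 2 * ∑ k, ∑ j, (∑ i, d3 Φ x e (b k) (b i) * d3 Φ x e (b i) (b j))
          * d3 Φ x e (b j) (b k)) := by
  -- With the frame fixed along the line through `x` in direction `e`, differentiation falls on Φ
  -- alone.
  have h := trace_derivs_of_det_eq_exp
    (g := fun t => Matrix.of fun i j => d2 Φ (x + t • e) (b i) (b j))
    (g₁ := fun t => Matrix.of fun i j => d3 Φ (x + t • e) e (b i) (b j))
    (g₂ := fun t => Matrix.of fun i j => d4 Φ (x + t • e) e e (b i) (b j))
    (g₃ := fun t => Matrix.of fun i j => d5 Φ (x + t • e) e e e (b i) (b j))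
    (p := fun t => Φ (x + t • e)) (p₁ := fun t => fderiv ℝ Φ (x + t • e) e)
    (p₂ := fun t => d2 Φ (x + t • e) e e) (p₃ := fun t => d3 Φ (x + t • e) e e e)
    (fun t i j => hasDerivAt_d2_line_apply hΦ x e (b i) (b j) t)
    (fun t i j => hasDerivAt_d3_line_apply hΦ x e e (b i) (b j) t)
    (fun t i j => hasDerivAt_d4_line_apply hΦ x e e e (b i) (b j) t)
    (fun t => hasDerivAt_line hΦ x e t)
    (fun t => by
      simpa using (hasDerivAt_fderiv_line hΦ x e t).clm_apply (hasDerivAt_const t e))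
    (fun t => hasDerivAt_d2_line_apply hΦ x e e e t) hc (fun t => hdet _)
    (by ext i j; simp [hb, Matrix.one_apply])
  simp only [zero_smul, add_zero, Matrix.trace, Matrix.mul_apply, Matrix.diag_apply,
    Matrix.of_apply] at h
  exact h

theorem d2_eq_of_hasDerivAt_line {E : Type*} [NormedAddCommGroup E] [NormedSpace ℝ E]
    {φ : E → ℝ} {U : Set E} (hU : IsOpen U) (hφ : ContDiffOn ℝ ∞ φ U)
    {x y : E} (hx : x ∈ U) {g : ℝ → ℝ} {s : ℝ}
    (hg : ∀ t : ℝ, x + t • y ∈ U → HasDerivAt (fun r : ℝ => φ (x + r • y)) (g t) t)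
    (hs : HasDerivAt g s 0) : d2 φ x y y = s := by
  have hline : ∀ t : ℝ, HasDerivAt (fun r : ℝ => x + r • y) y t := fun t => by
    simpa using ((hasDerivAt_id t).smul_const y).const_add x
  have hev : ∀ᶠ t : ℝ in nhds 0, x + t • y ∈ U := by
    have hc : Continuous fun t : ℝ => x + t • y := by fun_prop
    exact hc.continuousAt.preimage_mem_nhds (hU.mem_nhds (by simpa using hx))
  have heq : (fun t : ℝ => fderiv ℝ φ (x + t • y) y) =ᶠ[nhds 0] g := by
    filter_upwards [hev] with t ht
    have hd : DifferentiableAt ℝ φ (x + t • y) :=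
      (hφ.contDiffAt (hU.mem_nhds ht)).differentiableAt (by simp)
    exact (hd.hasFDerivAt.comp_hasDerivAt t (hline t)).unique (hg t ht)
  have hd2 : DifferentiableAt ℝ (fderiv ℝ φ) (x + (0 : ℝ) • y) := by
    have := (hφ.contDiffAt (hU.mem_nhds hx)).fderiv_right (m := ∞) (by simp)
    simpa using this.differentiableAt (by simp)
  have hF : HasDerivAt (fun t : ℝ => fderiv ℝ φ (x + t • y)) (d2 φ (x + (0 : ℝ) • y) y) 0 :=
    hd2.hasFDerivAt.comp_hasDerivAt (0 : ℝ) (hline 0)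
  have h' := (hF.clm_apply (hasDerivAt_const (0 : ℝ) y)).unique (hs.congr_of_eventuallyEq heq)
  simpa using h'

theorem hasDerivAt_mul_rpow {T q : ℝ → ℝ} {T₁ q₁ p t : ℝ} (hT : HasDerivAt T T₁ t)
    (hq : HasDerivAt q q₁ t) (h0 : q t ≠ 0) :
    HasDerivAt (fun s => T s * q s ^ p)
      (T₁ * q t ^ p + T t * (q₁ * p * q t ^ (p - 1))) t :=
  hT.mul (hq.rpow_const (Or.inl h0))

/-- As q = 1 and q' = 0 at 0, the cross term and the q'² term drop out. -/
theorem hasDerivAt_deriv_mul_rpow {T T₁ q q₁ : ℝ → ℝ} {p T₂ q₂ : ℝ} (hT : HasDerivAt T (T₁ 0) 0)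
    (hT₁ : HasDerivAt T₁ T₂ 0) (hq : HasDerivAt q (q₁ 0) 0) (hq₁ : HasDerivAt q₁ q₂ 0)
    (h0 : q 0 = 1) (h1 : q₁ 0 = 0) :
    HasDerivAt (fun t => T₁ t * q t ^ p + T t * (q₁ t * p * q t ^ (p - 1)))
      (T₂ + p * T 0 * q₂) 0 := by
  have hne : q 0 ≠ 0 := by simp [h0]
  have hr := fun r : ℝ => hq.rpow_const (p := r) (Or.inl hne)
  refine ((hT₁.mul (hr p)).add (hT.mul ((hq₁.mul_const p).mul (hr (p - 1))))).congr_deriv ?_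
  simp [h0, h1]
  ring

/-! ### Derivatives in a direction varying linearly with the point -/

section MovingDirection

variable {E : Type*} [NormedAddCommGroup E] [NormedSpace ℝ E] {Φ : E → ℝ} (hΦ : ContDiff ℝ ∞ Φ)

theorem hasDerivAt_add_smul (e w : E) (t : ℝ) : HasDerivAt (fun s : ℝ => e + s • w) w t := by
  simpa using ((hasDerivAt_id t).smul_const w).const_add e

include hΦ

theorem hasDerivAt_d2_diag (x y e w : E) (t : ℝ) :
    HasDerivAt (fun s : ℝ => d2 Φ (x + s • y) (e + s • w) (e + s • w))
      (d3 Φ (x + t • y) y (e + t • w) (e + t • w) + 2 * d2 Φ (x + t • y) (e + t • w) w) t := by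
  have hC := hasDerivAt_add_smul e w t
  refine (hasDerivAt_d2_moving hΦ x y hC hC).congr_deriv ?_
  rw [d2_swap hΦ _ w]
  ring

theorem hasDerivAt_d3_diag (x y e w : E) (t : ℝ) :
    HasDerivAt (fun s : ℝ => d3 Φ (x + s • y) (e + s • w) (e + s • w) (e + s • w))
      (d4 Φ (x + t • y) y (e + t • w) (e + t • w) (e + t • w)
        + 3 * d3 Φ (x + t • y) w (e + t • w) (e + t • w)) t := by
  have hC := hasDerivAt_add_smul e w t
  refine (hasDerivAt_d3_moving hΦ x y hC hC hC).congr_deriv ?_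
  rw [d3_swap₁ hΦ _ (e + t • w) w, d3_swap₂ hΦ _ (e + t • w) (e + t • w) w,
    d3_swap₁ hΦ _ (e + t • w) w]
  ring

theorem hasDerivAt_deriv_d2_diag (x y e w : E) :
    HasDerivAt (fun s : ℝ => d3 Φ (x + s • y) y (e + s • w) (e + s • w)
        + 2 * d2 Φ (x + s • y) (e + s • w) w)
      (d4 Φ x y y e e + 4 * d3 Φ x y e w + 2 * d2 Φ x w w) 0 := by
  have hC := hasDerivAt_add_smul e w 0
  have h3 := hasDerivAt_d3_moving hΦ x y (a := fun _ => y) (hasDerivAt_const 0 y) hC hC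
  have h2 := hasDerivAt_d2_moving hΦ x y (b := fun _ => w) hC (hasDerivAt_const 0 w)
  refine (h3.add (h2.const_mul 2)).congr_deriv ?_
  simp only [zero_smul, add_zero, map_zero, zero_apply]
  rw [d3_swap₂ hΦ x y w e]
  ring

theorem hasDerivAt_deriv_d3_diag (x y e w : E) :
    HasDerivAt (fun s : ℝ => d4 Φ (x + s • y) y (e + s • w) (e + s • w) (e + s • w)
        + 3 * d3 Φ (x + s • y) w (e + s • w) (e + s • w))
      (d5 Φ x y y e e e + 6 * d4 Φ x y e e w + 6 * d3 Φ x e w w) 0 := by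
  have hC := hasDerivAt_add_smul e w 0
  have h4 := hasDerivAt_d4_moving hΦ x y (a := fun _ => y) (hasDerivAt_const 0 y) hC hC hC
  have h3 := hasDerivAt_d3_moving hΦ x y (a := fun _ => w) (hasDerivAt_const 0 w) hC hC
  refine (h4.add (h3.const_mul 3)).congr_deriv ?_
  simp only [zero_smul, add_zero, map_zero, zero_apply]
  rw [d3_swap₂ hΦ x w w e, d3_swap₁ hΦ x w e w, d4_swap₂ hΦ x y w e e, d4_swap₃ hΦ x y e w e]
  ring

end MovingDirection

/-- The second derivative along a line of the normalized third derivative in a direction which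
varies linearly. -/
theorem d2_barrier {Φ φ : EuclideanSpace ℝ (Fin n) → ℝ} (hΦ : ContDiff ℝ ∞ Φ)
    {U : Set (EuclideanSpace ℝ (Fin n))} (hU : IsOpen U) (hφ : ContDiffOn ℝ ∞ φ U)
    {x y e w : EuclideanSpace ℝ (Fin n)} (hx : x ∈ U)
    (hline : ∀ t : ℝ, φ (x + t • y) = normalizedThird Φ (x + t • y) (e + t • w))
    (hpos : ∀ t : ℝ, x + t • y ∈ U → d2 Φ (x + t • y) (e + t • w) (e + t • w) ≠ 0)
    (he : d2 Φ x e e = 1) (hw : d3 Φ x y e e + 2 * d2 Φ x e w = 0) :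
    d2 φ x y y = d5 Φ x y y e e e + 6 * d4 Φ x y e e w + 6 * d3 Φ x e w w
      - 3 / 2 * d3 Φ x e e e * (d4 Φ x y y e e + 4 * d3 Φ x y e w + 2 * d2 Φ x w w) := by
  have hψ := hasDerivAt_deriv_mul_rpow (p := -(3 / 2)) (hasDerivAt_d3_diag hΦ x y e w 0)
    (hasDerivAt_deriv_d3_diag hΦ x y e w) (hasDerivAt_d2_diag hΦ x y e w 0)
    (hasDerivAt_deriv_d2_diag hΦ x y e w)
    (by simpa only [zero_smul, add_zero] using he) (by simpa only [zero_smul, add_zero] using hw)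
  rw [d2_eq_of_hasDerivAt_line hU hφ hx (fun t ht =>
    (hasDerivAt_mul_rpow (hasDerivAt_d3_diag hΦ x y e w t) (hasDerivAt_d2_diag hΦ x y e w t)
      (hpos t ht)).congr_of_eventuallyEq (.of_forall hline)) hψ]
  simp only [zero_smul, add_zero]
  ring

end Barrier

/-! ### Construction of the barrier and the final inequality -/

section Main

set_option synthInstance.maxHeartbeats 200000
set_option maxSynthPendingDepth 3

variable {n : ℕ}

theorem contDiffOn_normalizedThird {Φ : EuclideanSpace ℝ (Fin n) → ℝ} (hΦ : ContDiff ℝ ∞ Φ)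
    {ε : EuclideanSpace ℝ (Fin n) → EuclideanSpace ℝ (Fin n)} (hε : ContDiff ℝ ∞ ε) :
    ContDiffOn ℝ ∞ (fun x => normalizedThird Φ x (ε x)) {x | 0 < d2 Φ x (ε x) (ε x)} := by
  have h2 : ContDiff ℝ ∞ fun x => d2 Φ x (ε x) (ε x) :=
    ((contDiff_d2 hΦ).clm_apply hε).clm_apply hε
  have h3 : ContDiff ℝ ∞ fun x => d3 Φ x (ε x) (ε x) (ε x) :=
    (((contDiff_d3 hΦ).clm_apply hε).clm_apply hε).clm_apply hε
  exact h3.contDiffOn.mul (h2.contDiffOn.rpow_const_of_ne fun x hx => ne_of_gt hx)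

/-- The sum of the second derivatives of the barrier over a unit frame. Here `S` is the sum of the
products of the third and fourth derivatives, which cancels. -/
theorem barrier_sum_ge {n : ℕ} (i₀ : Fin n) {f S : ℝ} {p5 p4 m r α β : Fin n → ℝ} (hf : 0 ≤ f)
    (hα : ∑ k, p4 k = -1 + ∑ k, α k) (hS : ∑ k, m k = S)
    (h5 : ∑ k, p5 k = -f + 3 * S - 2 * ∑ k, β k) (hα₀ : α i₀ = f ^ 2) (hβ₀ : β i₀ = f ^ 3)
    (hnn : ∀ k, 0 ≤ α k) (hβ : ∀ k, k ≠ i₀ → β k ≤ f / 2 * α k)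
    (hr : ∀ k, r k = p5 k - 3 * m k + 3 / 2 * β k - 3 / 2 * f * (p4 k - 3 / 2 * α k)) :
    1 / 2 * f + 1 / 4 * f ^ 3 ≤ ∑ k, r k := by
  have hsum : ∑ k, r k = 1 / 2 * f + ∑ k, (3 / 4 * f * α k - 1 / 2 * β k) := by
    simp only [hr, Finset.sum_add_distrib, Finset.sum_sub_distrib, ← Finset.mul_sum]
    rw [hS, h5, hα]
    ring
  -- At `i₀` this is (3/4 - 1/2) f³; elsewhere β ≤ fα/2 leaves at least fα/2 ≥ 0.
  have hterm : ∀ k, (if k = i₀ then 1 / 4 * f ^ 3 else 0) ≤ 3 / 4 * f * α k - 1 / 2 * β k := by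
    intro k
    split_ifs with hk
    · rw [hk, hα₀, hβ₀]
      linarith
    · have := hβ k hk
      have := mul_nonneg hf (hnn k)
      linarith
  have h := Finset.sum_le_sum fun k (_ : k ∈ Finset.univ) => hterm k
  rw [Finset.sum_ite_eq' Finset.univ i₀] at h
  simp only [Finset.mem_univ, if_true] at h
  rw [hsum]
  linarith

namespace IsPotential

variable {Φ : EuclideanSpace ℝ (Fin n) → ℝ} (hΦ : IsPotential Φ)
include hΦ

set_option maxHeartbeats 1000000 in
/-- At every point the maximal third derivative has a smooth lower barrier. -/
theorem exists_barrier (hn : 1 ≤ n) (x₀ : EuclideanSpace ℝ (Fin n)) :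
    ∃ U : Set (EuclideanSpace ℝ (Fin n)), IsOpen U ∧ x₀ ∈ U ∧
      ∃ φ : EuclideanSpace ℝ (Fin n) → ℝ, ContDiffOn ℝ ∞ φ U ∧
        (∀ x ∈ U, φ x ≤ maxThirdDeriv Φ x) ∧ φ x₀ = maxThirdDeriv Φ x₀ ∧
        1 / 2 * maxThirdDeriv Φ x₀ + 1 / 4 * maxThirdDeriv Φ x₀ ^ 3
          ≤ weightedLaplacian Φ φ x₀ := by
  obtain ⟨e, he, hmax⟩ := (hΦ.isGreatest_maxThirdDeriv hn x₀).1
  rw [unitVectors, Set.mem_ofPred_eq, iteratedFDeriv_two_eq] at he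
  simp only [iteratedFDeriv_three_eq] at hmax
  have hΦs := hΦ.contDiff
  set i₀ : Fin n := ⟨0, hn⟩
  obtain ⟨b, hb₀, hb, hL, c, hc, hdet⟩ := hΦ.exists_orthonormal_frame i₀ he
  obtain ⟨htr4, htr5⟩ := trace_identities hΦs (e := e) hc hb hdet
  set A : Fin n → Fin n → ℝ := fun i j => d3 Φ x₀ e (b i) (b j) with hA
  have hAsymm : ∀ i j, A i j = A j i := fun i j => d3_swap₂ hΦs x₀ e (b i) (b j)
  set a : Fin n → EuclideanSpace ℝ (Fin n) := fun k => ∑ j, A j k • b j with ha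
  -- The first-order condition says that `e` is an eigenvector of `A`; hence `a k` is orthogonal to
  -- `e` for k ≠ i₀, and `A` need not be diagonalized.
  have hA₀ : ∀ j, A j i₀ = if j = i₀ then maxThirdDeriv Φ x₀ else 0 := by
    intro j
    rw [hAsymm]
    simp only [hA, hb₀]
    split_ifs with hj
    · rw [hj, hb₀, hmax]
    · refine (hΦ.conditions_of_isMax hn he hmax ?_).1
      rw [← hb₀, hb, if_neg (Ne.symm hj)]
  have ha₀ : a i₀ = maxThirdDeriv Φ x₀ • e := by
    simp [ha, hA₀, hb₀]
  have hae : ∀ k, d2 Φ x₀ e (a k) = A i₀ k := by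
    intro k
    simp only [ha, map_sum, map_smul, smul_eq_mul]
    simp [← hb₀, hb]
  have haa : ∀ k, d2 Φ x₀ (a k) (a k) = ∑ j, A k j * A j k := by
    intro k
    simp only [ha, map_sum, map_smul, smul_eq_mul, sum_apply, smul_apply]
    simp [hb, hAsymm k]
  have hbea : ∀ k, d3 Φ x₀ (b k) e (a k) = d2 Φ x₀ (a k) (a k) := by
    intro k
    rw [haa, d3_swap₁ hΦs]
    simp only [ha, map_sum, map_smul, smul_eq_mul]
    exact Finset.sum_congr rfl fun j _ => mul_comm _ _
  have heaa : ∀ k, d3 Φ x₀ e (a k) (a k) = ∑ j, (∑ i, A k i * A i j) * A j k := by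
    intro k
    simp only [ha, map_sum, map_smul, smul_eq_mul, sum_apply, smul_apply]
    refine Finset.sum_congr rfl fun j _ => ?_
    rw [Finset.sum_mul, Finset.mul_sum]
    refine Finset.sum_congr rfl fun i _ => ?_
    rw [hAsymm k i]
    simp only [hA]
    ring
  have h4 : ∀ k, d4 Φ x₀ (b k) e e (a k) = ∑ j, A k j * d4 Φ x₀ e e (b j) (b k) := by
    intro k
    simp only [ha, map_sum, map_smul, smul_eq_mul]
    refine Finset.sum_congr rfl fun j _ => ?_
    rw [hAsymm k j, d4_swap₁ hΦs, d4_swap₂ hΦs, d4_swap₃ hΦs]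
  -- The factor -1/2 comes from the Christoffel symbols: `e + B (x - x₀)` is parallel to first order
  -- at `x₀`.
  set B : EuclideanSpace ℝ (Fin n) →L[ℝ] EuclideanSpace ℝ (Fin n) :=
    (-(1 / 2) : ℝ) • ∑ j, (d3 Φ x₀ e (b j)).smulRight (b j) with hBdef
  have hB : ∀ k, B (b k) = (-(1 / 2) : ℝ) • a k := by
    intro k
    simp [hBdef, ha, hA, sum_apply]
  set ε : EuclideanSpace ℝ (Fin n) → EuclideanSpace ℝ (Fin n) := fun x => e + B (x - x₀) with hε
  have hεs : ContDiff ℝ ∞ ε := by fun_prop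
  have hε₀ : ε x₀ = e := by simp [hε]
  have hUo : IsOpen {x | 0 < d2 Φ x (ε x) (ε x)} := by
    have h2 := (contDiff_d2 hΦs).continuous
    have := hεs.continuous
    exact isOpen_lt continuous_const (by fun_prop)
  have hxU : x₀ ∈ {x | 0 < d2 Φ x (ε x) (ε x)} := by
    change 0 < d2 Φ x₀ (ε x₀) (ε x₀)
    rw [hε₀, he]
    exact one_pos
  have hφs := contDiffOn_normalizedThird hΦs hεs
  have hεline : ∀ k (t : ℝ), ε (x₀ + t • b k) = e + t • ((-(1 / 2) : ℝ) • a k) := by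
    intro k t
    simp only [hε, add_sub_cancel_left, map_smul, hB]
  refine ⟨_, hUo, hxU, fun x => normalizedThird Φ x (ε x), hφs, fun x hx => ?_, ?_, ?_⟩
  · exact (hΦ.isGreatest_maxThirdDeriv hn x).2 (normalizedThird_mem hx)
  · simp only [hε₀]
    rw [normalizedThird_of_unit he, hmax]
  · rw [hL]
    have hbee : ∀ k, d3 Φ x₀ (b k) e e = A i₀ k := by
      intro k
      rw [d3_swap₁ hΦs, d3_swap₂ hΦs]
      simp only [hA, hb₀]
    have hsecond := fun k => d2_barrier hΦs hUo hφs hxU (y := b k) (e := e)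
      (w := (-(1 / 2) : ℝ) • a k) (fun t => by simp only [hεline])
      (fun t ht => by rw [← hεline]; exact ne_of_gt ht) he
      -- The squared length of `ε` is stationary at `x₀`: Φ_{yee} cancels against 2h(e, w).
      (by rw [map_smul, hae, hbee, smul_eq_mul]; ring)
    refine barrier_sum_ge i₀ (hΦ.maxThirdDeriv_nonneg hn he hmax)
      (p4 := fun k => d4 Φ x₀ e e (b k) (b k)) (p5 := fun k => d5 Φ x₀ e e e (b k) (b k))
      (m := fun k => d4 Φ x₀ (b k) e e (a k)) (α := fun k => d2 Φ x₀ (a k) (a k))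
      (β := fun k => d3 Φ x₀ e (a k) (a k)) ?_ rfl ?_ ?_ ?_ ?_ ?_ ?_
    · simp only [haa]
      rw [htr4, he]
    · simp only [heaa, h4]
      rw [htr5, hmax]
    · simp only [ha₀, map_smul, smul_apply, smul_eq_mul, he]
      ring
    · simp only [ha₀, map_smul, smul_apply, smul_eq_mul, hmax]
      ring
    · exact fun k => d2_nonneg_of_convexOn hΦs hΦ.convexOn x₀ (a k)
    · intro k hk
      refine (hΦ.conditions_of_isMax hn he hmax ?_).2
      rw [hae, hAsymm, hA₀, if_neg hk]
    · intro k
      rw [hsecond k, hmax, d5_rotate hΦs x₀ (b k) (b k), d4_rotate hΦs x₀ (b k) (b k)]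
      simp only [map_smul, smul_apply, smul_eq_mul]
      rw [hbea]
      ring

end IsPotential

end Main

end KahlerEinstein

theorem mainTheorem6 (n : ℕ) (hn : 1 ≤ n) (Φ : EuclideanSpace ℝ (Fin n) → ℝ)
    (hΦ : KahlerEinstein.IsPotential Φ) :
    (∀ x, IsGreatest (KahlerEinstein.thirdDerivValues Φ x) (KahlerEinstein.maxThirdDeriv Φ x)) ∧
      KahlerEinstein.LaplacianGeInBarrierSense Φ (KahlerEinstein.maxThirdDeriv Φ)
        (fun x => (1 / 2) * KahlerEinstein.maxThirdDeriv Φ x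
          + (1 / 4) * KahlerEinstein.maxThirdDeriv Φ x ^ 3) :=
  ⟨hΦ.isGreatest_maxThirdDeriv hn, hΦ.continuous_maxThirdDeriv, hΦ.exists_barrier hn⟩
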